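/- Let $p(r,s)=r$ and $q(r,s)=s$ denote the coordinate projections $\mathbb{R}^2\to\mathbb{R}$. Let $X_{\mathbb N}=\{x_{n1},x_{n2}: n\in\mathbb N\}$ be a countable infinite set in $\mathbb{R}^2$, and let $\{V_n:n\in\mathbb N\}$ be a family of pairwise disjoint countable subsets of $\mathbb{R}^2\setminus X_{\mathbb N}$, each of which is dense in $\mathbb{R}^2$. Suppose that (1) $\lim_{n\to\infty} q(x_{n1})=+\infty$ and $\lim_{n\to\infty} q(x_{n2})=-\infty$; (2) for every $\beta\in p(X_{\mathbb N})$ there exists $\delta_\beta>0$ such that $X_{\mathbb N}\cap p^{-1}([\beta-\delta_\beta,\beta+\delta_\beta])$ is a finite set. Then there exists a homeomorphism $F:\mathbb{R}^2\to\mathbb{R}^2$ such that, for every $n\in\mathbb N$ and every $v\in V_n$, one has $\omega_F(v)=\{x_{n1}\}$ and $\alpha_F(v)=\{x_{n2}\}$. Here $\omega_F(v)$ is the set of all $y\in\mathbb{R}^2$ such that $F^{n_i}(v)\to y$ for some sequence of positive integers $n_1<n_2<\cdots$, and $\alpha_F(v)=\omega_{F^{-1}}(v)$. -/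

import Mathlib

open Filter Topology Set

/-- The ω-limit set of the point `x` under the homeomorphism `f`. -/
def pointOmega {X : Type*} [TopologicalSpace X] (f : X ≃ₜ X) (x : X) : Set X :=
  omegaLimit atTop (fun (n : ℕ) (y : X) => (⇑f)^[n] y) {x}

/-- The α-limit set of the point `x` under `f` is its ω-limit set under the inverse of `f`. -/
def pointAlpha {X : Type*} [TopologicalSpace X] (f : X ≃ₜ X) (x : X) : Set X :=
  pointOmega f.symm x

/-- In a first-countable space (such as the plane), `y` is an ω-limit point of `x` iff
`f^(n i) x → y` along some strictly increasing sequence `n` of positive integers. -/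
theorem mem_pointOmega_iff {X : Type*} [TopologicalSpace X] [FirstCountableTopology X]
    (f : X ≃ₜ X) (x y : X) :
    y ∈ pointOmega f x ↔ ∃ n : ℕ → ℕ, StrictMono n ∧ (∀ i, 0 < n i) ∧
      Tendsto (fun i => (⇑f)^[n i] x) atTop (𝓝 y) := by
  unfold pointOmega
  rw [mem_omegaLimit_singleton_iff_mapClusterPt]
  constructor
  · intro h
    obtain ⟨n, hn, ht⟩ := MapClusterPt.tendsto_subseq h
    refine ⟨fun i => n (i + 1), fun a b hab => hn (by omega), fun i => ?_, ?_⟩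
    · exact lt_of_lt_of_le (Nat.succ_pos i) (hn.le_apply (x := i + 1))
    · exact ht.comp (tendsto_add_atTop_nat 1)
  · rintro ⟨n, hn, -, ht⟩
    exact MapClusterPt.of_comp hn.tendsto_atTop ht.mapClusterPt

/-! Identify the plane with `ℂ`. Since the second coordinates of the target points tend to `±∞`,
these points form a locally finite set, and a homeomorphism (`exists_straightening`) carries them
into the negative real axis and all points of the `V n` into the slit plane, with distinct moduli.
It remains to drive countably many points of the slit plane to prescribed points of the slit
(`exists_homeo_driving`).

With `ρ = log ‖z‖` and `u = tan (arg z / 2) + κ ρ`, the slit plane becomes `ℝ²`, and the slit is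
reached as `u → ±∞` with `ρ` bounded. If `d` is continuous and vanishes at infinity, the map `(ρ, u)
↦ (ρ + d u, u + 1)` extends by the identity to a homeomorphism of the plane (`continuous_slitSkew`).
Forward orbits converge to `-exp (ρ + ∑ d (u + k))`, backward ones to `-exp (ρ - ∑ d (u - 1 - k))`,
whenever these sums converge. A generic `κ` makes the values `u` incongruent modulo `ℤ`, and
`exists_zeroAtInfty_hasSums` then finds one `d` with all the required sums. -/

open scoped ZeroAtInfty

/-! ### Prescribed sums along orbits of the unit translation. -/

theorem exists_periodic_bump (S : Finset ℝ) (a : ℝ) (h : ∀ s ∈ S, ∀ m : ℤ, a - s ≠ m) :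
    ∃ b : ℝ → ℝ, Continuous b ∧ Function.Periodic b 1 ∧ b a = 1 ∧ (∀ s ∈ S, b s = 0) ∧
      ∃ C : ℝ, 0 < C ∧ ∀ y, |b y| ≤ C := by
  have hne : ∀ s ∈ S, Real.sin (Real.pi * (a - s)) ≠ 0 := by
    intro s hs h0
    obtain ⟨m, hm⟩ := Real.sin_eq_zero_iff.1 h0
    apply h s hs m
    have := Real.pi_pos.ne'
    rw [mul_comm] at hm
    exact (mul_left_cancel₀ this hm).symm
  -- Each factor vanishes exactly on `s + ℤ` and is normalised to be `1` at `a`; squaring turns the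
  -- antiperiod `1` of the sine into a period.
  refine ⟨fun y => ∏ s ∈ S, Real.sin (Real.pi * (y - s)) ^ 2 / Real.sin (Real.pi * (a - s)) ^ 2,
    by fun_prop, ?_, ?_, ?_, ∏ s ∈ S, 1 / Real.sin (Real.pi * (a - s)) ^ 2, ?_, ?_⟩
  · intro y
    refine Finset.prod_congr rfl fun s _ => ?_
    have : Real.pi * (y + 1 - s) = Real.pi * (y - s) + Real.pi := by ring
    rw [this, Real.sin_add_pi, neg_sq]
  · exact Finset.prod_eq_one fun s hs => div_self (pow_ne_zero _ (hne s hs))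
  · intro s hs
    exact Finset.prod_eq_zero hs (by simp)
  · refine Finset.prod_pos fun s hs => ?_
    have := hne s hs
    positivity
  · intro y
    rw [Finset.abs_prod]
    refine Finset.prod_le_prod (fun _ _ => abs_nonneg _) fun s hs => ?_
    rw [abs_of_nonneg (by positivity)]
    gcongr
    exact Real.sin_sq_le_one _

/-- The sum of `d` along the forward orbit of `y` under the unit translation is `A`. -/
def HasForwardSum (d : ℝ → ℝ) (y A : ℝ) : Prop :=
  Tendsto (fun n : ℕ => ∑ k ∈ Finset.range n, d (y + k)) atTop (𝓝 A)

/-- The sum of `d` along the backward orbit of `y` under the unit translation is `B`. -/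
def HasBackwardSum (d : ℝ → ℝ) (y B : ℝ) : Prop :=
  Tendsto (fun n : ℕ => ∑ k ∈ Finset.range n, d (y - 1 - k)) atTop (𝓝 B)

theorem HasForwardSum.add {d e : ℝ → ℝ} {y A B : ℝ} (hd : HasForwardSum d y A)
    (he : HasForwardSum e y B) : HasForwardSum (fun x => d x + e x) y (A + B) := by
  simpa only [HasForwardSum, Finset.sum_add_distrib] using Tendsto.add hd he

theorem HasBackwardSum.add {d e : ℝ → ℝ} {y A B : ℝ} (hd : HasBackwardSum d y A)
    (he : HasBackwardSum e y B) : HasBackwardSum (fun x => d x + e x) y (A + B) := by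
  simpa only [HasBackwardSum, Finset.sum_add_distrib] using Tendsto.add hd he

theorem HasForwardSum.congr {d e : ℝ → ℝ} {y A : ℝ} (hd : HasForwardSum d y A)
    (h : ∀ k : ℤ, e (y + k) = d (y + k)) : HasForwardSum e y A := by
  refine Tendsto.congr (fun n => Finset.sum_congr rfl fun k _ => ?_) hd
  simpa using (h k).symm

theorem HasBackwardSum.congr {d e : ℝ → ℝ} {y A : ℝ} (hd : HasBackwardSum d y A)
    (h : ∀ k : ℤ, e (y + k) = d (y + k)) : HasBackwardSum e y A := by
  refine Tendsto.congr (fun n => Finset.sum_congr rfl fun k _ => ?_) hd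
  have := (h (-1 - k)).symm
  push_cast at this
  rwa [← add_sub_assoc, ← sub_eq_add_neg] at this

/-- The periodic factor is constant along an orbit, so the sum telescopes. -/
theorem hasForwardSum_mul_diff {b g : ℝ → ℝ} (hb : Function.Periodic b 1) {A : ℝ}
    (hg : Tendsto g atTop (𝓝 A)) (y : ℝ) :
    HasForwardSum (fun x => b x * (g (x + 1) - g x)) y (b y * (A - g y)) := by
  have h : ∀ n : ℕ, ∑ k ∈ Finset.range n, b (y + k) * (g (y + k + 1) - g (y + k)) =
      b y * (g (y + n) - g y) := by
    intro n
    induction n with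
    | zero => simp
    | succ n ih =>
      have : b (y + n) = b y := by simpa using hb.nat_mul n y
      rw [Finset.sum_range_succ, ih, this]
      push_cast
      rw [add_assoc y]
      ring
  refine Tendsto.congr (fun n => (h n).symm) ?_
  exact ((hg.comp (tendsto_atTop_add_const_left _ y tendsto_natCast_atTop_atTop)).sub_const
    _).const_mul _

theorem hasBackwardSum_mul_diff {b g : ℝ → ℝ} (hb : Function.Periodic b 1) {A : ℝ}
    (hg : Tendsto g atBot (𝓝 A)) (y : ℝ) :
    HasBackwardSum (fun x => b x * (g (x + 1) - g x)) y (b y * (g y - A)) := by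
  have h : ∀ n : ℕ, ∑ k ∈ Finset.range n, b (y - 1 - k) * (g (y - 1 - k + 1) - g (y - 1 - k)) =
      b y * (g y - g (y + -n)) := by
    intro n
    induction n with
    | zero => simp
    | succ n ih =>
      have h1 : b (y - 1 - n) = b y := by
        have := hb.sub_nat_mul_eq (x := y) (n + 1)
        push_cast at this
        rw [← this]
        congr 1
        ring
      have h2 : y - 1 - n + 1 = y + -n := by ring
      have h3 : y + -((n + 1 : ℕ) : ℝ) = y - 1 - n := by push_cast; ring
      rw [Finset.sum_range_succ, ih, h1, h2, h3]
      ring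
  refine Tendsto.congr (fun n => (h n).symm) ?_
  exact ((hg.comp (tendsto_atBot_add_const_left _ y
    (tendsto_neg_atTop_atBot.comp tendsto_natCast_atTop_atTop))).const_sub _).const_mul _

/-- A continuous function with value `0` at `a` and prescribed limits at `±∞` which varies slowly. -/
theorem exists_slow_function (a A B ε : ℝ) (hε : 0 < ε) :
    ∃ g : ℝ → ℝ, Continuous g ∧ g a = 0 ∧ Tendsto g atTop (𝓝 A) ∧ Tendsto g atBot (𝓝 B) ∧
      ∀ y, |g (y + 1) - g y| ≤ ε := by
  -- Two ramps of width `N` change by at most `(|A| + |B|) / N ≤ ε` per unit step; the `+ 1` keeps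
  -- `N` positive when `A = B = 0`.
  set N : ℝ := (|A| + |B|) / ε + 1 with hN
  have hN0 : 0 < N := by positivity
  have key : ∀ x y : ℝ, |max 0 (min 1 x) - max 0 (min 1 y)| ≤ |x - y| := by
    intro x y
    have h1 := abs_max_sub_max_le_abs (min 1 x) (min 1 y) 0
    have h2 := abs_min_sub_min_le_max 1 x 1 y
    rw [max_comm 0, max_comm 0]
    refine h1.trans (h2.trans ?_)
    simp
  refine ⟨fun y => A * max 0 (min 1 ((y - a) / N)) + B * max 0 (min 1 ((a - y) / N)),
    by fun_prop, by simp, ?_, ?_, ?_⟩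
  · refine tendsto_const_nhds.congr' ?_
    filter_upwards [eventually_ge_atTop (a + N)] with y hy
    have h1 : 1 ≤ (y - a) / N := by rw [le_div_iff₀ hN0]; linarith
    have h2 : (a - y) / N ≤ 0 := div_nonpos_of_nonpos_of_nonneg (by linarith) hN0.le
    rw [min_eq_left h1, max_eq_left (min_le_of_right_le h2)]
    simp
  · refine tendsto_const_nhds.congr' ?_
    filter_upwards [eventually_le_atBot (a - N)] with y hy
    have h1 : 1 ≤ (a - y) / N := by rw [le_div_iff₀ hN0]; linarith
    have h2 : (y - a) / N ≤ 0 := div_nonpos_of_nonpos_of_nonneg (by linarith) hN0.le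
    rw [min_eq_left h1, max_eq_left (min_le_of_right_le h2)]
    simp
  · intro y
    have h1 := key ((y + 1 - a) / N) ((y - a) / N)
    have h2 := key ((a - (y + 1)) / N) ((a - y) / N)
    have e1 : (y + 1 - a) / N - (y - a) / N = 1 / N := by ring
    have e2 : (a - (y + 1)) / N - (a - y) / N = -(1 / N) := by ring
    rw [e1, abs_of_pos (show 0 < 1 / N by positivity)] at h1
    rw [e2, abs_neg, abs_of_pos (show 0 < 1 / N by positivity)] at h2
    calc _ = |A * (max 0 (min 1 ((y + 1 - a) / N)) - max 0 (min 1 ((y - a) / N))) +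
          B * (max 0 (min 1 ((a - (y + 1)) / N)) - max 0 (min 1 ((a - y) / N)))| := by
            congr 1; ring
      _ ≤ |A| * (1 / N) + |B| * (1 / N) := by
        refine (abs_add_le _ _).trans ?_
        rw [abs_mul, abs_mul]
        gcongr
      _ = (|A| + |B|) / N := by ring
      _ ≤ ε := by
        rw [div_le_iff₀ hN0, hN, mul_add, mul_div_cancel₀ _ hε.ne']
        linarith

/-- Take `E y = b y * (g (y + 1) - g y)`: the bump `b` kills the orbits of `S`, telescoping gives
the sums at `a`, and slow variation of `g` makes `E` small. Since `g` has limits at `±∞`, `E`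
vanishes at infinity and all its orbit sums converge. -/
theorem exists_correction (S : Finset ℝ) (a : ℝ) (h : ∀ s ∈ S, ∀ m : ℤ, a - s ≠ m)
    (A B ε : ℝ) (hε : 0 < ε) :
    ∃ E : C₀(ℝ, ℝ), (∀ y, |E y| ≤ ε) ∧ (∀ s ∈ S, ∀ k : ℤ, E (s + k) = 0) ∧
      HasForwardSum E a A ∧ HasBackwardSum E a B ∧
      ∀ y, (∃ l, HasForwardSum E y l) ∧ ∃ l, HasBackwardSum E y l := by
  obtain ⟨b, hbc, hbp, hba, hbS, C, hC, hbC⟩ := exists_periodic_bump S a h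
  obtain ⟨g, hgc, hga, hgA, hgB, hgε⟩ := exists_slow_function a A (-B) (ε / C) (by positivity)
  have hbound : ∀ y, |b y * (g (y + 1) - g y)| ≤ C * |g (y + 1) - g y| := by
    intro y
    rw [abs_mul]
    gcongr
    exact hbC y
  have hlim : Tendsto (fun y => g (y + 1) - g y) (cocompact ℝ) (𝓝 0) := by
    rw [cocompact_eq_atBot_atTop]
    refine Tendsto.sup ?_ ?_
    · simpa using (hgB.comp (tendsto_atBot_add_const_right _ 1 tendsto_id)).sub hgB
    · simpa using (hgA.comp (tendsto_atTop_add_const_right _ 1 tendsto_id)).sub hgA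
  refine ⟨⟨⟨fun y => b y * (g (y + 1) - g y), by fun_prop⟩, ?_⟩, ?_, ?_, ?_, ?_, ?_⟩
  · refine squeeze_zero_norm (fun y => hbound y) ?_
    simpa using hlim.abs.const_mul C
  · intro y
    refine (hbound y).trans ?_
    have := hgε y
    rw [le_div_iff₀ hC] at this
    rwa [mul_comm]
  · intro s hs k
    have : b (s + k) = b s := by simpa using hbp.int_mul k s
    change b (s + k) * _ = 0
    rw [this, hbS s hs, zero_mul]
  · have := hasForwardSum_mul_diff hbp hgA a
    rwa [hba, hga, one_mul, sub_zero] at this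
  · have := hasBackwardSum_mul_diff hbp hgB a
    rwa [hba, hga, one_mul, zero_sub, neg_neg] at this
  · exact fun y => ⟨⟨_, hasForwardSum_mul_diff hbp hgA y⟩, ⟨_, hasBackwardSum_mul_diff hbp hgB y⟩⟩

/-- A function vanishing at infinity with prescribed sums along countably many orbits of the unit
translation. -/
theorem exists_zeroAtInfty_hasSums {ι : Type*} [Countable ι] (u A B : ι → ℝ)
    (hu : ∀ i j, i ≠ j → ∀ m : ℤ, u i - u j ≠ m) :
    ∃ d : C₀(ℝ, ℝ), ∀ i, HasForwardSum d (u i) (A i) ∧ HasBackwardSum d (u i) (B i) := by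
  classical
  obtain ⟨c, hc⟩ := exists_injective_nat ι
  -- The next correction is the target minus the current sum, so convergence of all orbit sums must
  -- be kept as an invariant.
  let T := {D : C₀(ℝ, ℝ) // ∀ y, (∃ l, HasForwardSum D y l) ∧ ∃ l, HasBackwardSum D y l}
  have step : ∀ (n : ℕ) (D : T), ∃ D' : T, dist D.1 D'.1 ≤ 1 / 2 / 2 ^ n ∧
      (∀ i, c i < n → ∀ k : ℤ, D'.1 (u i + k) = D.1 (u i + k)) ∧
      ∀ i, c i = n → HasForwardSum D'.1 (u i) (A i) ∧ HasBackwardSum D'.1 (u i) (B i) := by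
    rintro n ⟨D, hD⟩
    by_cases hn : ∃ i, c i = n
    · obtain ⟨i, rfl⟩ := hn
      have hfin : {j | c j < c i}.Finite :=
        Set.Finite.preimage hc.injOn (Set.finite_Iio (c i))
      obtain ⟨⟨l, hl⟩, l', hl'⟩ := hD (u i)
      obtain ⟨E, hEε, hES, hEA, hEB, hE⟩ := exists_correction (hfin.toFinset.image u) (u i)
        (by
          intro s hs m
          simp only [Finset.mem_image, Set.Finite.mem_toFinset, Set.mem_ofPred_eq] at hs
          obtain ⟨j, hj, rfl⟩ := hs
          exact hu i j (by rintro rfl; exact lt_irrefl _ hj) m)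
        (A i - l) (B i - l') (1 / 2 / 2 ^ c i) (by positivity)
      refine ⟨⟨D + E, fun y => ?_⟩, ?_, ?_, ?_⟩
      · obtain ⟨⟨a, ha⟩, b, hb⟩ := hD y
        obtain ⟨⟨a', ha'⟩, b', hb'⟩ := hE y
        exact ⟨⟨_, ha.add ha'⟩, ⟨_, hb.add hb'⟩⟩
      · rw [dist_comm, dist_eq_norm, add_sub_cancel_left,
          ← ZeroAtInftyContinuousMap.norm_toBCF_eq_norm]
        exact (BoundedContinuousFunction.norm_le (by positivity)).2 hEε
      · intro j hj k
        have := hES (u j) (by simpa using ⟨j, hj, rfl⟩) k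
        simp [this]
      · intro j hj
        obtain rfl := hc hj
        have h1 := hl.add hEA
        have h2 := hl'.add hEB
        rw [add_sub_cancel] at h1 h2
        exact ⟨h1, h2⟩
    · refine ⟨⟨D, hD⟩, by rw [dist_self]; positivity, fun _ _ _ => rfl, fun i hi => (hn ⟨i, hi⟩).elim⟩
  choose next hdist hkeep hnew using step
  let D : ℕ → T := fun n => Nat.rec
    ⟨0, fun y => ⟨⟨0, by simp [HasForwardSum]⟩, ⟨0, by simp [HasBackwardSum]⟩⟩⟩ next n
  have hD : ∀ n, D (n + 1) = next n (D n) := fun _ => rfl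
  have hcauchy : CauchySeq fun n => (D n).1 :=
    cauchySeq_of_le_geometric_two (C := 1) fun n => by rw [hD]; exact hdist n (D n)
  obtain ⟨d, hd⟩ := cauchySeq_tendsto_of_complete hcauchy
  -- Values on the orbit of `u i` freeze after stage `c i`, so the uniform limit inherits its sums
  -- there without any exchange of limits.
  have hstab : ∀ i n, c i + 1 ≤ n → ∀ k : ℤ, (D n).1 (u i + k) = (D (c i + 1)).1 (u i + k) := by
    intro i n hn k
    induction n, hn using Nat.le_induction with
    | base => rfl
    | succ n hn ih => rw [← ih, hD, hkeep n (D n) i hn k]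
  have hval : ∀ i, ∀ k : ℤ, d (u i + k) = (D (c i + 1)).1 (u i + k) := by
    intro i k
    have h1 : Tendsto (fun n => (D n).1 (u i + k)) atTop (𝓝 (d (u i + k))) := by
      rw [tendsto_iff_dist_tendsto_zero] at hd ⊢
      refine squeeze_zero (fun _ => dist_nonneg) (fun n => ?_) hd
      rw [← ZeroAtInftyContinuousMap.dist_toBCF_eq_dist]
      exact BoundedContinuousFunction.dist_coe_le_dist (f := (D n).1.toBCF) (g := d.toBCF) (u i + k)
    refine tendsto_nhds_unique h1 (tendsto_const_nhds.congr' ?_)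
    filter_upwards [eventually_ge_atTop (c i + 1)] with n hn
    exact (hstab i n hn k).symm
  refine ⟨d, fun i => ?_⟩
  obtain ⟨h1, h2⟩ := hnew (c i) (D (c i)) i rfl
  exact ⟨h1.congr (hval i), h2.congr (hval i)⟩

/-! ### Half-angle coordinate on the slit plane. -/

/-- The Cayley parametrization of the unit circle minus `-1`. -/
noncomputable def cayley (y : ℝ) : ℂ := (1 + y * Complex.I) / (1 - y * Complex.I)

/-- The tangent of half the argument of `z`. -/
noncomputable def halfSlope (z : ℂ) : ℝ := z.im / (‖z‖ + z.re)

theorem one_sub_mul_I_ne_zero (y : ℝ) : (1 - y * Complex.I : ℂ) ≠ 0 := by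
  intro h
  simpa using congrArg Complex.re h

theorem continuous_cayley : Continuous cayley := by
  unfold cayley
  exact Continuous.div (by fun_prop) (by fun_prop) one_sub_mul_I_ne_zero

theorem cayley_eq (y : ℝ) :
    cayley y = ((2 / (1 + y ^ 2) - 1 : ℝ) : ℂ) + ((2 * y / (1 + y ^ 2) : ℝ) : ℂ) * Complex.I := by
  have h : (1 + (y : ℂ) ^ 2) ≠ 0 := by
    have : (1 + y ^ 2 : ℝ) ≠ 0 := by positivity
    exact_mod_cast this
  rw [cayley, div_eq_iff (one_sub_mul_I_ne_zero y)]
  push_cast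
  field_simp
  ring_nf
  simp only [Complex.I_sq]
  ring

theorem cayley_re (y : ℝ) : (cayley y).re = 2 / (1 + y ^ 2) - 1 := by
  rw [cayley_eq]; simp [-Complex.ofReal_sub, -Complex.ofReal_div]

theorem cayley_im (y : ℝ) : (cayley y).im = 2 * y / (1 + y ^ 2) := by
  rw [cayley_eq]; simp [-Complex.ofReal_sub, -Complex.ofReal_div]

theorem norm_cayley (y : ℝ) : ‖cayley y‖ = 1 := by
  have h : (1 + y ^ 2 : ℝ) ≠ 0 := by positivity
  have : ‖cayley y‖ ^ 2 = 1 := by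
    rw [← Complex.normSq_eq_norm_sq, Complex.normSq_apply, cayley_re, cayley_im]
    field_simp
    ring
  exact (pow_eq_one_iff_of_nonneg (norm_nonneg _) two_ne_zero).1 this

theorem tendsto_cayley : Tendsto cayley (cocompact ℝ) (𝓝 (-1)) := by
  rw [tendsto_iff_norm_sub_tendsto_zero]
  have h : ∀ y : ℝ, ‖cayley y - -1‖ ^ 2 = 4 * (1 + y ^ 2)⁻¹ := by
    intro y
    have h : (1 + y ^ 2 : ℝ) ≠ 0 := by positivity
    rw [← Complex.normSq_eq_norm_sq, Complex.normSq_apply]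
    simp only [Complex.sub_re, Complex.sub_im, Complex.neg_re, Complex.neg_im, Complex.one_re,
      Complex.one_im, cayley_re, cayley_im]
    field_simp
    ring
  have h2 : Tendsto (fun y : ℝ => ‖cayley y - -1‖ ^ 2) (cocompact ℝ) (𝓝 0) := by
    simp only [h]
    rw [← mul_zero (4 : ℝ)]
    refine Tendsto.const_mul _ (tendsto_inv_atTop_zero.comp ?_)
    refine tendsto_atTop_add_const_left _ _ ?_
    have := (tendsto_pow_atTop (α := ℝ) two_ne_zero).comp (tendsto_norm_cocompact_atTop (E := ℝ))
    simpa [Function.comp_def] using this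
  have h3 := h2.sqrt
  simpa [Real.sqrt_sq (norm_nonneg _)] using h3

theorem tendsto_norm_atTop_iff_tendsto_cocompact {α : Type*} {l : Filter α} {f : α → ℝ} :
    Tendsto (fun x => ‖f x‖) l atTop ↔ Tendsto f l (cocompact ℝ) := by
  rw [← Metric.cobounded_eq_cocompact, ← tendsto_norm_atTop_iff_cobounded]

theorem norm_add_re_pos {z : ℂ} (hz : z ∈ Complex.slitPlane) : 0 < ‖z‖ + z.re := by
  have h := neg_le_of_abs_le (Complex.abs_re_le_norm z)
  rcases hz with h1 | h1
  · linarith [norm_nonneg z]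
  · have := (Complex.abs_re_lt_norm (z := z)).2 h1
    linarith [(abs_lt.1 this).1]

theorem sq_im_eq (z : ℂ) : z.im ^ 2 = (‖z‖ - z.re) * (‖z‖ + z.re) := by
  have := Complex.sq_norm z
  rw [Complex.normSq_apply] at this
  linarith

theorem norm_mul_cayley_halfSlope {z : ℂ} (hz : z ∈ Complex.slitPlane) :
    (‖z‖ : ℂ) * cayley (halfSlope z) = z := by
  have h0 := norm_add_re_pos hz
  have hn : 0 < ‖z‖ := norm_pos_iff.2 (Complex.slitPlane_ne_zero hz)
  have h1 : 1 + halfSlope z ^ 2 = 2 * ‖z‖ / (‖z‖ + z.re) := by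
    rw [halfSlope, div_pow, sq_im_eq]
    field_simp
    ring
  apply Complex.ext
  · rw [Complex.re_ofReal_mul, cayley_re, h1]
    field_simp
    ring
  · rw [Complex.im_ofReal_mul, cayley_im, h1, halfSlope]
    field_simp

theorem continuousAt_halfSlope {z : ℂ} (hz : z ∈ Complex.slitPlane) : ContinuousAt halfSlope z := by
  unfold halfSlope
  exact ContinuousAt.div (by fun_prop) (by fun_prop) (norm_add_re_pos hz).ne'

/-- The square of `halfSlope z` is `(‖z‖ - z.re) / (‖z‖ + z.re)`, whose denominator tends to `0` at
the slit. The sign depends on the side of approach, hence the filter `cocompact ℝ`. -/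
theorem tendsto_halfSlope_cocompact {z₀ : ℂ} (hz₀ : z₀ ∉ Complex.slitPlane) (h0 : z₀ ≠ 0) :
    Tendsto halfSlope (𝓝[Complex.slitPlane] z₀) (cocompact ℝ) := by
  rw [Complex.mem_slitPlane_iff, not_or, not_lt, not_not] at hz₀
  obtain ⟨hre, him⟩ := hz₀
  have hnorm : ‖z₀‖ = -z₀.re := by
    rw [← abs_of_nonpos hre]
    exact (Complex.abs_re_eq_norm.2 him).symm
  have hpos : 0 < ‖z₀‖ := norm_pos_iff.2 h0
  rw [← tendsto_norm_atTop_iff_tendsto_cocompact]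
  have hsq : Tendsto (fun z => (‖z‖ - z.re) * (‖z‖ + z.re)⁻¹) (𝓝[Complex.slitPlane] z₀) atTop := by
    refine Tendsto.pos_mul_atTop (C := ‖z₀‖ - z₀.re) (by linarith) ?_ ?_
    · exact (Continuous.tendsto (by fun_prop) z₀).mono_left nhdsWithin_le_nhds
    · refine tendsto_inv_nhdsGT_zero.comp (tendsto_nhdsWithin_iff.2 ⟨?_, ?_⟩)
      · have : Tendsto (fun z : ℂ => ‖z‖ + z.re) (𝓝 z₀) (𝓝 (‖z₀‖ + z₀.re)) :=
          Continuous.tendsto (by fun_prop) z₀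
        rw [hnorm, neg_add_cancel] at this
        exact this.mono_left nhdsWithin_le_nhds
      · exact eventually_nhdsWithin_of_forall fun z hz => norm_add_re_pos hz
  refine (Real.tendsto_sqrt_atTop.comp hsq).congr' ?_
  refine eventually_nhdsWithin_of_forall fun z hz => ?_
  have h1 := norm_add_re_pos hz
  simp only [Function.comp_apply]
  rw [Real.norm_eq_abs, ← Real.sqrt_sq_eq_abs]
  congr 1
  rw [halfSlope, div_pow, sq_im_eq]
  field_simp

/-! ### The skew translation and its orbits. -/

/-- Sheared logarithmic polar coordinates on the slit plane. -/
noncomputable def polarMap (κ : ℝ) (p : ℝ × ℝ) : ℂ := (Real.exp p.1 : ℂ) * cayley (p.2 - κ * p.1)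

/-- The inverse of `polarMap`. -/
noncomputable def polarInv (κ : ℝ) (z : ℂ) : ℝ × ℝ :=
  (Real.log ‖z‖, halfSlope z + κ * Real.log ‖z‖)

theorem norm_polarMap (κ : ℝ) (p : ℝ × ℝ) : ‖polarMap κ p‖ = Real.exp p.1 := by
  rw [polarMap, norm_mul, norm_cayley, mul_one, Complex.norm_real, Real.norm_eq_abs, Real.abs_exp]

theorem polarMap_re (κ : ℝ) (p : ℝ × ℝ) :
    (polarMap κ p).re = Real.exp p.1 * (2 / (1 + (p.2 - κ * p.1) ^ 2) - 1) := by
  rw [polarMap, Complex.re_ofReal_mul, cayley_re]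

theorem polarMap_im (κ : ℝ) (p : ℝ × ℝ) :
    (polarMap κ p).im = Real.exp p.1 * (2 * (p.2 - κ * p.1) / (1 + (p.2 - κ * p.1) ^ 2)) := by
  rw [polarMap, Complex.im_ofReal_mul, cayley_im]

theorem polarMap_mem (κ : ℝ) (p : ℝ × ℝ) : polarMap κ p ∈ Complex.slitPlane := by
  rw [Complex.mem_slitPlane_iff, polarMap_re, polarMap_im]
  by_cases h : p.2 - κ * p.1 = 0
  · left
    rw [h]
    norm_num
    positivity
  · right
    positivity

theorem polarInv_polarMap (κ : ℝ) (p : ℝ × ℝ) : polarInv κ (polarMap κ p) = p := by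
  have h : halfSlope (polarMap κ p) = p.2 - κ * p.1 := by
    have h1 : (1 + (p.2 - κ * p.1) ^ 2) ≠ 0 := by positivity
    have h2 := (Real.exp_pos p.1).ne'
    rw [halfSlope, norm_polarMap, polarMap_re, polarMap_im]
    field_simp
    ring
  rw [polarInv, h, norm_polarMap, Real.log_exp]
  simp

theorem polarMap_polarInv (κ : ℝ) {z : ℂ} (hz : z ∈ Complex.slitPlane) :
    polarMap κ (polarInv κ z) = z := by
  have hn : 0 < ‖z‖ := norm_pos_iff.2 (Complex.slitPlane_ne_zero hz)
  rw [polarMap, polarInv, Real.exp_log hn]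
  simpa using norm_mul_cayley_halfSlope hz

theorem continuous_polarMap (κ : ℝ) : Continuous (polarMap κ) := by
  unfold polarMap
  have := continuous_cayley
  fun_prop

theorem continuousAt_polarInv (κ : ℝ) {z : ℂ} (hz : z ∈ Complex.slitPlane) :
    ContinuousAt (polarInv κ) z := by
  have h1 := continuousAt_halfSlope hz
  have h2 : ContinuousAt (fun z : ℂ => Real.log ‖z‖) z :=
    ContinuousAt.log (by fun_prop) (norm_ne_zero_iff.2 (Complex.slitPlane_ne_zero hz))
  unfold polarInv
  exact h2.prodMk (h1.add (h2.const_mul κ))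

open Classical in
/-- The map equal to the skew translation `(ρ, u) ↦ (ρ + d u, u + s)` in sheared polar coordinates
on the slit plane, and to the identity elsewhere. -/
noncomputable def slitSkew (κ s : ℝ) (d : ℝ → ℝ) (z : ℂ) : ℂ :=
  if z ∈ Complex.slitPlane then
    polarMap κ ((polarInv κ z).1 + d (polarInv κ z).2, (polarInv κ z).2 + s)
  else z

theorem slitSkew_of_mem (κ s : ℝ) (d : ℝ → ℝ) {z : ℂ} (hz : z ∈ Complex.slitPlane) :
    slitSkew κ s d z =
      polarMap κ ((polarInv κ z).1 + d (polarInv κ z).2, (polarInv κ z).2 + s) := if_pos hz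

theorem slitSkew_of_notMem (κ s : ℝ) (d : ℝ → ℝ) {z : ℂ} (hz : z ∉ Complex.slitPlane) :
    slitSkew κ s d z = z := if_neg hz

theorem slitSkew_polarMap (κ s : ℝ) (d : ℝ → ℝ) (p : ℝ × ℝ) :
    slitSkew κ s d (polarMap κ p) = polarMap κ (p.1 + d p.2, p.2 + s) := by
  rw [slitSkew_of_mem _ _ _ (polarMap_mem κ p), polarInv_polarMap]

theorem slitSkew_slitSkew (κ s s' : ℝ) (d d' : ℝ → ℝ) (hs : s + s' = 0)
    (hd : ∀ u, d' (u + s) = -d u) (z : ℂ) : slitSkew κ s' d' (slitSkew κ s d z) = z := by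
  by_cases hz : z ∈ Complex.slitPlane
  · rw [slitSkew_of_mem κ s d hz, slitSkew_polarMap]
    simp only [hd]
    rw [add_neg_cancel_right, add_assoc, hs, add_zero]
    exact polarMap_polarInv κ hz
  · rw [slitSkew_of_notMem κ s d hz, slitSkew_of_notMem _ _ _ hz]

theorem tendsto_cocompact_add {α : Type*} {l : Filter α} {f g : α → ℝ} {c : ℝ}
    (hf : Tendsto f l (cocompact ℝ)) (hg : Tendsto g l (𝓝 c)) :
    Tendsto (fun x => f x + g x) l (cocompact ℝ) := by
  rw [← tendsto_norm_atTop_iff_tendsto_cocompact] at hf ⊢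
  refine tendsto_atTop_mono (fun x => ?_) (hf.atTop_add hg.norm.neg)
  have := norm_sub_le (f x + g x) (g x)
  rw [add_sub_cancel_right] at this
  linarith

/-- Only points off the slit plane need care. At `0`, boundedness of `d` controls the modulus. At a
nonzero point of the slit, `u` escapes to infinity, so `d u → 0` and both modulus and direction
converge to those of the point. -/
theorem continuous_slitSkew (κ s : ℝ) {d : ℝ → ℝ} (hd : Continuous d)
    (hd0 : Tendsto d (cocompact ℝ) (𝓝 0)) : Continuous (slitSkew κ s d) := by
  rw [continuous_iff_continuousAt]
  intro z₀
  by_cases hz₀ : z₀ ∈ Complex.slitPlane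
  · have h1 := continuousAt_polarInv κ hz₀
    have h2 : ContinuousAt (fun z => polarMap κ
        ((polarInv κ z).1 + d (polarInv κ z).2, (polarInv κ z).2 + s)) z₀ := by
      have h3 : Continuous fun p : ℝ × ℝ => polarMap κ (p.1 + d p.2, p.2 + s) :=
        (continuous_polarMap κ).comp (by fun_prop)
      exact h3.continuousAt.comp h1
    refine h2.congr ?_
    filter_upwards [Complex.isOpen_slitPlane.mem_nhds hz₀] with z hz
    exact (slitSkew_of_mem κ s d hz).symm
  rw [ContinuousAt, slitSkew_of_notMem κ s d hz₀]
  rw [← nhdsWithin_univ, ← union_compl_self Complex.slitPlane, nhdsWithin_union]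
  refine Tendsto.sup ?_ ?_
  swap
  · refine Tendsto.congr' (f₁ := id) ?_ ?_
    · exact eventually_nhdsWithin_of_forall fun z hz => (slitSkew_of_notMem κ s d hz).symm
    · rw [← nhdsWithin_union, union_compl_self, nhdsWithin_univ]
      exact nhdsWithin_le_nhds
  rw [← nhdsWithin_union, union_compl_self, nhdsWithin_univ]
  by_cases h0 : z₀ = 0
  · subst h0
    let D : C₀(ℝ, ℝ) := ⟨⟨d, hd⟩, hd0⟩
    have hD : ∀ u, d u ≤ ‖D‖ := fun u =>
      (le_abs_self _).trans (by
        rw [← ZeroAtInftyContinuousMap.norm_toBCF_eq_norm]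
        exact D.toBCF.norm_coe_le_norm u)
    have hlim : Tendsto (fun z : ℂ => ‖z‖ * Real.exp ‖D‖) (𝓝[Complex.slitPlane] 0) (𝓝 0) := by
      have : Tendsto (fun z : ℂ => ‖z‖ * Real.exp ‖D‖) (𝓝 0) (𝓝 (‖(0 : ℂ)‖ * Real.exp ‖D‖)) :=
        Continuous.tendsto (by fun_prop) 0
      rw [norm_zero, zero_mul] at this
      exact this.mono_left nhdsWithin_le_nhds
    refine squeeze_zero_norm' ?_ hlim
    refine eventually_nhdsWithin_of_forall fun z hz => ?_
    have hn : 0 < ‖z‖ := norm_pos_iff.2 (Complex.slitPlane_ne_zero hz)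
    rw [slitSkew_of_mem κ s d hz, norm_polarMap, Real.exp_add, polarInv, Real.exp_log hn]
    gcongr
    exact hD _
  have hslope := tendsto_halfSlope_cocompact hz₀ h0
  have hlog : Tendsto (fun z : ℂ => Real.log ‖z‖) (𝓝[Complex.slitPlane] z₀)
      (𝓝 (Real.log ‖z₀‖)) :=
    (ContinuousAt.log (f := fun z : ℂ => ‖z‖) (by fun_prop)
      (norm_ne_zero_iff.2 h0)).tendsto.mono_left nhdsWithin_le_nhds
  have hu : Tendsto (fun z => d (polarInv κ z).2) (𝓝[Complex.slitPlane] z₀) (𝓝 0) :=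
    hd0.comp (tendsto_cocompact_add hslope (hlog.const_mul κ))
  -- This is the half-slope of the image: `u + s - κ * (ρ + d u)` with `u = halfSlope z + κ * ρ`.
  have hy : Tendsto (fun z => halfSlope z + (s - κ * d (polarInv κ z).2))
      (𝓝[Complex.slitPlane] z₀) (cocompact ℝ) :=
    tendsto_cocompact_add hslope ((hu.const_mul κ).const_sub s)
  have hexp : Tendsto (fun z => ((Real.exp (Real.log ‖z‖ + d (polarInv κ z).2) : ℝ) : ℂ))
      (𝓝[Complex.slitPlane] z₀) (𝓝 (‖z₀‖ : ℂ)) := by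
    have := (Complex.continuous_ofReal.comp Real.continuous_exp).continuousAt.tendsto.comp
      (hlog.add hu)
    rw [Function.comp_apply, add_zero, Real.exp_log (norm_pos_iff.2 h0)] at this
    exact this
  have hprod := hexp.mul (tendsto_cayley.comp hy)
  have hz : (‖z₀‖ : ℂ) * -1 = z₀ := by
    rw [Complex.mem_slitPlane_iff, not_or, not_lt, not_not] at hz₀
    have hnorm : ‖z₀‖ = -z₀.re := by
      rw [← abs_of_nonpos hz₀.1]
      exact (Complex.abs_re_eq_norm.2 hz₀.2).symm
    apply Complex.ext <;> simp [hnorm, hz₀.2]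
  rw [hz] at hprod
  refine hprod.congr' ?_
  refine eventually_nhdsWithin_of_forall fun z hz => ?_
  rw [slitSkew_of_mem κ s d hz, polarMap]
  simp only [Function.comp_apply, polarInv]
  congr 2
  ring

theorem slitSkew_iterate (κ s : ℝ) (d : ℝ → ℝ) (p : ℝ × ℝ) (n : ℕ) :
    (slitSkew κ s d)^[n] (polarMap κ p) =
      polarMap κ (p.1 + ∑ k ∈ Finset.range n, d (p.2 + k * s), p.2 + n * s) := by
  induction n with
  | zero => simp
  | succ n ih =>
    rw [Function.iterate_succ_apply', ih, slitSkew_polarMap, Finset.sum_range_succ]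
    push_cast
    congr 2 <;> ring

theorem tendsto_slitSkew_iterate (κ : ℝ) {s : ℝ} (hs : s ≠ 0) (d : ℝ → ℝ) (p : ℝ × ℝ) {A : ℝ}
    (hA : Tendsto (fun n : ℕ => ∑ k ∈ Finset.range n, d (p.2 + k * s)) atTop (𝓝 A)) :
    Tendsto (fun n => (slitSkew κ s d)^[n] (polarMap κ p)) atTop
      (𝓝 (-(Real.exp (p.1 + A) : ℂ))) := by
  simp only [slitSkew_iterate]
  have h1 := hA.const_add p.1
  have hn : Tendsto (fun n : ℕ => (n : ℝ) * s) atTop (cocompact ℝ) := by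
    rw [← tendsto_norm_atTop_iff_tendsto_cocompact]
    simp only [norm_mul, Real.norm_natCast]
    exact tendsto_natCast_atTop_atTop.atTop_mul_const (norm_pos_iff.2 hs)
  have h2 := tendsto_cocompact_add hn ((h1.const_mul κ).const_sub p.2)
  have h3 := ((Complex.continuous_ofReal.comp Real.continuous_exp).tendsto _).comp h1
  have h4 := h3.mul (tendsto_cayley.comp h2)
  rw [mul_neg_one] at h4
  refine h4.congr fun n => ?_
  simp only [Function.comp_apply, polarMap]
  congr 2
  ring

/-- The skew translation of the slit plane as a homeomorphism of the plane. -/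
noncomputable def slitSkewHomeo (κ : ℝ) (d : C₀(ℝ, ℝ)) : ℂ ≃ₜ ℂ where
  toFun := slitSkew κ 1 d
  invFun := slitSkew κ (-1) fun u => -d (u - 1)
  left_inv := slitSkew_slitSkew κ 1 (-1) _ _ (by norm_num) (by simp)
  right_inv := slitSkew_slitSkew κ (-1) 1 _ _ (by norm_num) (by simp [sub_eq_add_neg])
  continuous_toFun := continuous_slitSkew κ 1 d.continuous d.zero_at_infty'
  continuous_invFun := by
    refine continuous_slitSkew κ (-1) (by fun_prop) ?_
    have h : Tendsto (fun u : ℝ => u - 1) (cocompact ℝ) (cocompact ℝ) :=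
      tendsto_cocompact_add (g := fun _ => -1) tendsto_id tendsto_const_nhds
    simpa using (d.zero_at_infty'.comp h).neg

theorem tendsto_slitSkewHomeo_iterate (κ : ℝ) (d : C₀(ℝ, ℝ)) (p : ℝ × ℝ) {A : ℝ}
    (hA : HasForwardSum d p.2 A) :
    Tendsto (fun n => (slitSkewHomeo κ d)^[n] (polarMap κ p)) atTop
      (𝓝 (-(Real.exp (p.1 + A) : ℂ))) :=
  tendsto_slitSkew_iterate κ one_ne_zero d p (by simpa [HasForwardSum] using hA)

theorem tendsto_slitSkewHomeo_symm_iterate (κ : ℝ) (d : C₀(ℝ, ℝ)) (p : ℝ × ℝ) {B : ℝ}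
    (hB : HasBackwardSum d p.2 B) :
    Tendsto (fun n => (slitSkewHomeo κ d).symm^[n] (polarMap κ p)) atTop
      (𝓝 (-(Real.exp (p.1 - B) : ℂ))) := by
  refine tendsto_slitSkew_iterate κ (s := -1) (A := -B) (by norm_num) (fun u => -d (u - 1)) p ?_
  refine Tendsto.congr (fun n => ?_) (Tendsto.neg hB)
  rw [← Finset.sum_neg_distrib]
  refine Finset.sum_congr rfl fun k _ => ?_
  congr 2
  ring

/-! ### Straightening by rotation of circles. -/

/-- Rotation of each circle about `0` of radius `r` by the angle `θ r`. -/
noncomputable def twist (θ : C(ℝ, ℝ)) : ℂ ≃ₜ ℂ where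
  toFun w := w * Complex.exp (θ ‖w‖ * Complex.I)
  invFun w := w * Complex.exp (-(θ ‖w‖ * Complex.I))
  left_inv w := by
    simp only [norm_mul, Complex.norm_exp_ofReal_mul_I, mul_one]
    rw [mul_assoc, ← Complex.exp_add, add_neg_cancel, Complex.exp_zero, mul_one]
  right_inv w := by
    simp only [norm_mul, ← neg_mul, ← Complex.ofReal_neg, Complex.norm_exp_ofReal_mul_I, mul_one]
    rw [mul_assoc, ← Complex.exp_add]
    simp
  continuous_toFun := by fun_prop
  continuous_invFun := by fun_prop

theorem twist_apply (θ : C(ℝ, ℝ)) (w : ℂ) :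
    twist θ w = w * Complex.exp (θ ‖w‖ * Complex.I) := rfl

theorem norm_twist (θ : C(ℝ, ℝ)) (w : ℂ) : ‖twist θ w‖ = ‖w‖ := by
  rw [twist_apply, norm_mul, Complex.norm_exp_ofReal_mul_I, mul_one]

theorem exists_notMem_of_countable {s : Set ℝ} (hs : s.Countable) : ∃ t, t ∉ s :=
  (hs.dense_compl ℝ).nonempty

/-- Some point has pairwise distinct positive distances to the points of a countable set. -/
theorem exists_center {W : Set ℂ} (hW : W.Countable) :
    ∃ c, c ∉ W ∧ InjOn (fun z => ‖z - c‖) W := by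
  -- The centre is sought on a parabola, which meets every perpendicular bisector in finitely many
  -- points.
  let γ : ℝ → ℂ := fun t => ⟨t, t ^ 2⟩
  have h1 : (⋃ x ∈ W, {t : ℝ | γ t = x}).Countable := by
    refine hW.biUnion fun x _ => Set.Subsingleton.countable ?_
    intro a ha b hb
    have : γ a = γ b := ha.trans hb.symm
    exact congrArg Complex.re this
  have h2 : (⋃ x ∈ W, ⋃ y ∈ W, {t : ℝ | x ≠ y ∧ ‖x - γ t‖ = ‖y - γ t‖}).Countable := by
    refine hW.biUnion fun x _ => hW.biUnion fun y _ => Set.Finite.countable ?_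
    by_cases hxy : x = y
    · simp [hxy]
    open Polynomial in
    -- `P` is the difference of the squared distances from `γ t` to `x` and `y`; the terms `t ^ 2 +
    -- t ^ 4` cancel.
    let P : ℝ[X] := Polynomial.C (x.re ^ 2 + x.im ^ 2 - y.re ^ 2 - y.im ^ 2) +
      Polynomial.C (2 * (y.re - x.re)) * Polynomial.X +
      Polynomial.C (2 * (y.im - x.im)) * Polynomial.X ^ 2
    have hP : P ≠ 0 := by
      intro h0
      apply hxy
      have c1 : P.coeff 1 = 2 * (y.re - x.re) := by
        simp only [P, Polynomial.coeff_add, Polynomial.coeff_C_mul, Polynomial.coeff_C,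
          Polynomial.coeff_X, Polynomial.coeff_X_pow]
        norm_num
      have c2 : P.coeff 2 = 2 * (y.im - x.im) := by
        simp only [P, Polynomial.coeff_add, Polynomial.coeff_C_mul, Polynomial.coeff_C,
          Polynomial.coeff_X, Polynomial.coeff_X_pow]
        norm_num
      rw [h0, Polynomial.coeff_zero] at c1 c2
      apply Complex.ext <;> linarith
    refine (P.rootSet_finite ℝ).subset ?_
    rintro t ⟨-, ht⟩
    rw [Polynomial.mem_rootSet]
    refine ⟨hP, ?_⟩
    have hsq : ‖x - γ t‖ ^ 2 = ‖y - γ t‖ ^ 2 := by rw [ht]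
    simp only [← Complex.normSq_eq_norm_sq, Complex.normSq_apply, Complex.sub_re, Complex.sub_im,
      γ] at hsq
    simp only [P, map_add, map_mul, map_pow, Polynomial.aeval_C, Polynomial.aeval_X,
      Algebra.algebraMap_self, RingHom.id_apply]
    linarith
  obtain ⟨t, ht⟩ := exists_notMem_of_countable (h1.union h2)
  simp only [mem_union, mem_iUnion, mem_ofPred_eq, not_or, not_exists] at ht
  refine ⟨γ t, fun h => ht.1 _ h rfl, fun x hx y hy hxy => ?_⟩
  by_contra hne
  exact ht.2 x hx y hy ⟨hne, hxy⟩

theorem isClosed_of_finite_inter_closedBall {T : Set ℝ}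
    (h : ∀ R : ℝ, (T ∩ Metric.closedBall 0 R).Finite) : IsClosed T := by
  rw [← isOpen_compl_iff, Metric.isOpen_iff]
  intro x hx
  have hfin := h (‖x‖ + 1)
  have hopen : IsOpen (T ∩ Metric.closedBall 0 (‖x‖ + 1))ᶜ := hfin.isClosed.isOpen_compl
  obtain ⟨ε, hε, hsub⟩ := Metric.isOpen_iff.1 hopen x fun h' => hx h'.1
  refine ⟨min ε 1, by positivity, fun y hy hyT => ?_⟩
  rw [Metric.mem_ball, lt_min_iff] at hy
  refine hsub (Metric.mem_ball.2 hy.1) ⟨hyT, ?_⟩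
  rw [mem_closedBall_zero_iff]
  have := norm_le_norm_add_norm_sub' y x
  rw [← dist_eq_norm] at this
  linarith [hy.2]

/-- A real function on a locally finite subset of the line extends continuously. -/
theorem exists_continuous_interpolation {K : Set ℝ}
    (h : ∀ R : ℝ, (K ∩ Metric.closedBall 0 R).Finite) (f : ℝ → ℝ) :
    ∃ g : C(ℝ, ℝ), ∀ r ∈ K, g r = f r := by
  have hsub : ∀ T ⊆ K, IsClosed T := fun T hT =>
    isClosed_of_finite_inter_closedBall fun R => (h R).subset (inter_subset_inter_left _ hT)
  have hdisc : DiscreteTopology K := by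
    rw [discreteTopology_iff_forall_isClosed]
    intro s
    have := (hsub (Subtype.val '' s) (by rintro _ ⟨a, -, rfl⟩; exact a.2)).preimage
      (continuous_subtype_val (p := (· ∈ K)))
    rwa [Set.preimage_image_eq s Subtype.val_injective] at this
  obtain ⟨g, hg⟩ := ContinuousMap.exists_restrict_eq (hsub K subset_rfl)
    (⟨fun r : K => f r, continuous_of_discreteTopology⟩ : C(K, ℝ))
  exact ⟨g, fun r hr => congrArg (fun φ : C(K, ℝ) => φ ⟨r, hr⟩) hg⟩

/-- The rotation angle is `g + t * φ`: `g` brings `X` to the negative axis, and `φ` vanishes on the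
moduli of `X` but at no modulus of `V`. Each `v` rules out countably many `t`, so a generic `t`
works. -/
theorem exists_twist {X V : Set ℂ} (hX : ∀ R : ℝ, (X ∩ Metric.closedBall 0 R).Finite)
    (hV : V.Countable) (hXV : Disjoint X V) (hinj : InjOn (fun z : ℂ => ‖z‖) (X ∪ V))
    (hV0 : (0 : ℂ) ∉ V) :
    ∃ θ : C(ℝ, ℝ), (∀ x ∈ X, twist θ x = -(‖x‖ : ℂ)) ∧ ∀ v ∈ V, twist θ v ∈ Complex.slitPlane := by
  classical
  set K : Set ℝ := (fun z : ℂ => ‖z‖) '' X with hKdef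
  have hK : ∀ R : ℝ, (K ∩ Metric.closedBall 0 R).Finite := by
    intro R
    refine ((hX R).image fun z : ℂ => ‖z‖).subset ?_
    rintro _ ⟨⟨z, hz, rfl⟩, hR⟩
    exact ⟨z, ⟨hz, by simpa using hR⟩, rfl⟩
  have hKc := isClosed_of_finite_inter_closedBall hK
  choose! pre hpre using fun r (hr : r ∈ K) => hr
  obtain ⟨g, hg⟩ := exists_continuous_interpolation hK fun r => -Complex.arg (-(pre r))
  have hgX : ∀ x ∈ X, g ‖x‖ = -Complex.arg (-x) := by
    intro x hx
    have hxK : ‖x‖ ∈ K := ⟨x, hx, rfl⟩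
    rw [hg _ hxK, hinj (Or.inl (hpre _ hxK).1) (Or.inl hx) (hpre _ hxK).2]
  have hneg : ∀ w : ℂ, w = -(‖w‖ * Complex.exp (Complex.arg (-w) * Complex.I)) := by
    intro w
    have := Complex.norm_mul_exp_arg_mul_I (-w)
    rw [norm_neg] at this
    rw [this, neg_neg]
  -- `Metric.infDist` to the empty set is `0`, so the case of empty `X` needs a nonzero default.
  let φ : ℝ → ℝ := fun r => if X.Nonempty then Metric.infDist r K else 1
  have hφ : Continuous φ := by
    by_cases h : X.Nonempty
    · simpa [φ, h] using Metric.continuous_infDist_pt K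
    · simpa [φ, h] using continuous_const
  have hφX : ∀ x ∈ X, φ ‖x‖ = 0 := by
    intro x hx
    have : X.Nonempty := ⟨x, hx⟩
    simpa [φ, this] using Metric.infDist_zero_of_mem (s := K) ⟨x, hx, rfl⟩
  have hφV : ∀ v ∈ V, φ ‖v‖ ≠ 0 := by
    intro v hv
    by_cases h : X.Nonempty
    · simp only [φ, h, if_true]
      intro h0
      obtain ⟨x, hx, hxv⟩ := (hKc.mem_iff_infDist_zero (h.image _)).2 h0
      have := hinj (Or.inl hx) (Or.inr hv) hxv
      subst this
      exact hXV.le_bot ⟨hx, hv⟩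
    · simp [φ, h]
  have hbad : (⋃ v ∈ V, range fun m : ℤ =>
      (m * (2 * Real.pi) - Complex.arg (-v) - g ‖v‖) / φ ‖v‖).Countable :=
    hV.biUnion fun v _ => countable_range _
  obtain ⟨t, ht⟩ := exists_notMem_of_countable hbad
  simp only [mem_iUnion, mem_range, not_exists] at ht
  refine ⟨⟨fun r => g r + t * φ r, by fun_prop⟩, ?_, ?_⟩
  · intro x hx
    rw [twist_apply, ContinuousMap.coe_mk, hφX x hx, hgX x hx, mul_zero, add_zero]
    nth_rewrite 1 [hneg x]
    rw [neg_mul, mul_assoc, ← Complex.exp_add]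
    simp
  · intro v hv
    have hv0 : v ≠ 0 := fun h => hV0 (h ▸ hv)
    have hn : (‖v‖ : ℂ) ≠ 0 := by simpa using hv0
    rw [twist_apply, ContinuousMap.coe_mk]
    nth_rewrite 1 [hneg v]
    rw [neg_mul, mul_assoc, ← Complex.exp_add, ← add_mul, ← Complex.ofReal_add]
    -- Angles are measured from the negative axis: the image of `v` is `-‖v‖ * exp (α * I)`, which
    -- lies on the slit only if `α` is a multiple of `2π`.
    set α : ℝ := Complex.arg (-v) + (g ‖v‖ + t * φ ‖v‖) with hα
    by_contra hmem
    rw [Complex.mem_slitPlane_iff, not_or, not_lt, not_not] at hmem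
    have hvpos : 0 < ‖v‖ := norm_pos_iff.2 hv0
    rw [Complex.neg_re, Complex.neg_im, Complex.re_ofReal_mul, Complex.im_ofReal_mul,
      Complex.exp_ofReal_mul_I_re, Complex.exp_ofReal_mul_I_im, neg_eq_zero, mul_eq_zero,
      neg_nonpos] at hmem
    have hsin : Real.sin α = 0 := hmem.2.resolve_left hvpos.ne'
    have hcos : 0 ≤ Real.cos α := nonneg_of_mul_nonneg_right hmem.1 hvpos
    have hcos1 : Real.cos α = 1 := by nlinarith [Real.sin_sq_add_cos_sq α]
    obtain ⟨m, hm⟩ := (Real.cos_eq_one_iff α).1 hcos1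
    refine ht v hv m ?_
    rw [div_eq_iff (hφV v hv), hm, hα]
    ring

/-- A homeomorphism of the plane moving a locally finite set into the negative real axis and a
disjoint countable set off it. -/
theorem exists_straightening {X V : Set ℂ} (hX : ∀ R : ℝ, (X ∩ Metric.closedBall 0 R).Finite)
    (hV : V.Countable) (hXV : Disjoint X V) :
    ∃ Ψ : ℂ ≃ₜ ℂ, (∀ x ∈ X, ∃ r : ℝ, Ψ x = -(Real.exp r : ℂ)) ∧
      (∀ v ∈ V, Ψ v ∈ Complex.slitPlane) ∧ InjOn (fun v => ‖Ψ v‖) V := by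
  have hXc : X.Countable := by
    have : X = ⋃ n : ℕ, X ∩ Metric.closedBall 0 (n : ℝ) := by
      rw [← inter_iUnion, Metric.iUnion_closedBall_nat, inter_univ]
    rw [this]
    exact countable_iUnion fun n => (hX n).countable
  obtain ⟨c, hc, hinj⟩ := exists_center (hXc.union hV)
  let τ : ℂ ≃ₜ ℂ := Homeomorph.subRight c
  have hτ : ∀ z, τ z = z - c := fun _ => rfl
  obtain ⟨θ, hθX, hθV⟩ := exists_twist (X := τ '' X) (V := τ '' V)
    (by
      intro R
      refine ((hX (R + ‖c‖)).image τ).subset ?_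
      rintro _ ⟨⟨z, hz, rfl⟩, hR⟩
      refine ⟨z, ⟨hz, ?_⟩, rfl⟩
      rw [mem_closedBall_zero_iff, hτ] at hR
      rw [mem_closedBall_zero_iff]
      linarith [norm_le_norm_add_norm_sub' z c, norm_sub_rev z c])
    (hV.image τ) ((disjoint_image_iff τ.injective).2 hXV)
    (by
      rw [← image_union]
      rintro _ ⟨x, hx, rfl⟩ _ ⟨y, hy, rfl⟩ hxy
      rw [hinj hx hy hxy])
    (by
      rintro ⟨v, hv, hv0⟩
      rw [hτ, sub_eq_zero] at hv0
      exact hc (hv0 ▸ Or.inr hv))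
  refine ⟨τ.trans (twist θ), fun x hx => ?_, fun v hv => hθV _ ⟨v, hv, rfl⟩, ?_⟩
  · have hpos : 0 < ‖τ x‖ := by
      rw [norm_pos_iff, hτ, sub_ne_zero]
      rintro rfl
      exact hc (Or.inl hx)
    refine ⟨Real.log ‖τ x‖, ?_⟩
    rw [Real.exp_log hpos]
    exact hθX _ ⟨x, hx, rfl⟩
  · intro v hv w hw hvw
    simp only [Homeomorph.trans_apply, norm_twist] at hvw
    exact hinj (Or.inr hv) (Or.inr hw) hvw

/-! ### Limit sets, generic shear and conjugation. -/

theorem pointOmega_eq_singleton {X : Type*} [TopologicalSpace X] [FirstCountableTopology X]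
    [T2Space X] (f : X ≃ₜ X) {x y : X} (h : Tendsto (fun n => f^[n] x) atTop (𝓝 y)) :
    pointOmega f x = {y} := by
  ext z
  rw [mem_pointOmega_iff, mem_singleton_iff]
  constructor
  · rintro ⟨n, hn, -, hz⟩
    exact tendsto_nhds_unique hz (h.comp hn.tendsto_atTop)
  · rintro rfl
    exact ⟨fun i => i + 1, fun a b hab => by simpa using hab, fun i => i.succ_pos,
      h.comp (tendsto_add_atTop_nat 1)⟩

/-- Each triple `(i, j, m)` with `i ≠ j` excludes a single `κ`, because `b i ≠ b j`. -/
theorem exists_shear_incongruent {ι : Type*} [Countable ι] (a b : ι → ℝ)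
    (hb : Function.Injective b) :
    ∃ κ : ℝ, ∀ i j, i ≠ j → ∀ m : ℤ, a i + κ * b i - (a j + κ * b j) ≠ m := by
  obtain ⟨κ, hκ⟩ := exists_notMem_of_countable (countable_range fun p : ι × ι × ℤ =>
    (p.2.2 - (a p.1 - a p.2.1)) / (b p.1 - b p.2.1))
  refine ⟨κ, fun i j hij m h => hκ ⟨(i, j, m), ?_⟩⟩
  have : b i - b j ≠ 0 := sub_ne_zero.2 (hb.ne hij)
  simp only
  rw [div_eq_iff this, ← h]
  ring

/-- Countably many points off the negative real axis with distinct moduli can be driven to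
prescribed points of the negative real axis by the forward and backward iterates of a single
homeomorphism. -/
theorem exists_homeo_driving {ι : Type*} [Countable ι] (z : ι → ℂ)
    (hz : ∀ i, z i ∈ Complex.slitPlane) (hinj : Function.Injective fun i => ‖z i‖) (r s : ι → ℝ) :
    ∃ G : ℂ ≃ₜ ℂ, ∀ i,
      Tendsto (fun n => G^[n] (z i)) atTop (𝓝 (-(Real.exp (r i) : ℂ))) ∧
      Tendsto (fun n => G.symm^[n] (z i)) atTop (𝓝 (-(Real.exp (s i) : ℂ))) := by
  have hpos : ∀ i, 0 < ‖z i‖ := fun i => norm_pos_iff.2 (Complex.slitPlane_ne_zero (hz i))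
  obtain ⟨κ, hκ⟩ := exists_shear_incongruent (fun i => halfSlope (z i))
    (fun i => Real.log ‖z i‖) fun i j hij =>
      hinj (Real.log_injOn_pos (hpos i) (hpos j) hij)
  let p : ι → ℝ × ℝ := fun i => polarInv κ (z i)
  have hp : ∀ i, polarMap κ (p i) = z i := fun i => polarMap_polarInv κ (hz i)
  -- With `ρ = (p i).1`, the limits are `-exp (ρ + A)` and `-exp (ρ - B)`, so `A = r i - ρ` and `B =
  -- ρ - s i`.
  obtain ⟨d, hd⟩ := exists_zeroAtInfty_hasSums (fun i => (p i).2) (fun i => r i - (p i).1)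
    (fun i => (p i).1 - s i) hκ
  refine ⟨slitSkewHomeo κ d, fun i => ?_⟩
  have h1 := tendsto_slitSkewHomeo_iterate κ d (p i) (hd i).1
  have h2 := tendsto_slitSkewHomeo_symm_iterate κ d (p i) (hd i).2
  rw [hp, add_sub_cancel] at h1
  rw [hp, sub_sub_cancel] at h2
  exact ⟨h1, h2⟩

theorem tendsto_conj_iterate {X Y : Type*} [TopologicalSpace X] [TopologicalSpace Y]
    (Φ : X ≃ₜ Y) (g : Y → Y) {x y : X}
    (h : Tendsto (fun n => g^[n] (Φ x)) atTop (𝓝 (Φ y))) (f : X → X)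
    (hf : ∀ a, Φ (f a) = g (Φ a)) : Tendsto (fun n => f^[n] x) atTop (𝓝 y) := by
  have h1 := (Φ.symm.continuous.tendsto _).comp h
  rw [Φ.symm_apply_apply] at h1
  refine h1.congr fun n => ?_
  have h2 : Function.Semiconj Φ f g := hf
  rw [Function.comp_apply, ← (h2.iterate_right n).eq, Φ.symm_apply_apply]

theorem finite_range_inter_of_tendsto_abs {x : ℕ → ℂ}
    (h : Tendsto (fun n => |(x n).im|) atTop atTop) (R : ℝ) :
    (range x ∩ Metric.closedBall 0 R).Finite := by
  have hfin : {n | ¬ R < |(x n).im|}.Finite := by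
    have := h.eventually_gt_atTop R
    rwa [← Nat.cofinite_eq_atTop, eventually_cofinite] at this
  refine (hfin.image x).subset ?_
  rintro _ ⟨⟨n, rfl⟩, hn⟩
  rw [mem_closedBall_zero_iff] at hn
  exact ⟨n, not_lt.2 ((Complex.abs_im_le_norm _).trans hn), rfl⟩

theorem corollary5p2 (x₁ x₂ : ℕ → ℝ × ℝ) (V : ℕ → Set (ℝ × ℝ))
    (hX : (range x₁ ∪ range x₂).Infinite)
    (hVdisj : Pairwise fun m n => Disjoint (V m) (V n))
    (hVcount : ∀ n, (V n).Countable)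
    (hVX : ∀ n, V n ⊆ (range x₁ ∪ range x₂)ᶜ)
    (hVdense : ∀ n, Dense (V n))
    (h₁ : Tendsto (fun n => (x₁ n).2) atTop atTop ∧ Tendsto (fun n => (x₂ n).2) atTop atBot)
    (h₂ : ∀ β ∈ Prod.fst '' (range x₁ ∪ range x₂), ∃ δ : ℝ, 0 < δ ∧
      ((range x₁ ∪ range x₂) ∩ Prod.fst ⁻¹' Icc (β - δ) (β + δ)).Finite) :
    ∃ F : (ℝ × ℝ) ≃ₜ (ℝ × ℝ), ∀ n, ∀ v ∈ V n,
      pointOmega F v = {x₁ n} ∧ pointAlpha F v = {x₂ n} := by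
  let e : (ℝ × ℝ) ≃ₜ ℂ := Complex.equivRealProdCLM.symm.toHomeomorph
  have he : ∀ p, (e p).im = p.2 := fun p => by simp [e]
  obtain ⟨Ψ, hΨX, hΨV, hΨinj⟩ := exists_straightening
    (X := range (e ∘ x₁) ∪ range (e ∘ x₂)) (V := e '' ⋃ n, V n)
    (by
      intro R
      rw [union_inter_distrib_right]
      refine (finite_range_inter_of_tendsto_abs ?_ R).union
        (finite_range_inter_of_tendsto_abs ?_ R)
      · simpa only [Function.comp_def, he] using tendsto_abs_atTop_atTop.comp h₁.1
      · simpa only [Function.comp_def, he] using tendsto_abs_atBot_atTop.comp h₁.2)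
    ((countable_iUnion hVcount).image e)
    (by
      rw [range_comp, range_comp, ← image_union, disjoint_image_iff e.injective,
        disjoint_iUnion_right]
      exact fun n => (subset_compl_iff_disjoint_left.1 (hVX n)))
  let Φ : (ℝ × ℝ) ≃ₜ ℂ := e.trans Ψ
  choose r₁ hr₁ using fun n => hΨX (e (x₁ n)) (Or.inl ⟨n, rfl⟩)
  choose r₂ hr₂ using fun n => hΨX (e (x₂ n)) (Or.inr ⟨n, rfl⟩)
  have : Countable (⋃ n, V n) := (countable_iUnion hVcount).to_subtype
  -- `N v` is an index of a set containing `v`; disjointness makes it the only one.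
  choose N hN using fun v : ⋃ n, V n => mem_iUnion.1 v.2
  obtain ⟨G, hG⟩ := exists_homeo_driving (fun v : ⋃ n, V n => Φ v)
    (fun v => hΨV _ ⟨v, v.2, rfl⟩)
    (fun v w hvw => Subtype.ext (e.injective (hΨinj ⟨v, v.2, rfl⟩ ⟨w, w.2, rfl⟩ hvw)))
    (fun v => r₁ (N v)) (fun v => r₂ (N v))
  refine ⟨Φ.trans (G.trans Φ.symm), fun n v hv => ?_⟩
  let v' : ⋃ n, V n := ⟨v, mem_iUnion.2 ⟨n, hv⟩⟩
  have hn : N v' = n := by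
    by_contra hne
    exact (hVdisj hne).le_bot ⟨hN v', hv⟩
  obtain ⟨hf, hb⟩ := hG v'
  rw [hn, ← hr₁] at hf
  rw [hn, ← hr₂] at hb
  exact ⟨pointOmega_eq_singleton _ (tendsto_conj_iterate Φ G hf _ fun a => by simp),
    pointOmega_eq_singleton _ (tendsto_conj_iterate Φ G.symm hb _ fun a => by simp)⟩
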